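/- Let $\omega^*=\beta\omega\setminus\omega$ be the Čech–Stone remainder of the countable discrete space $\omega$, and let $\mathcal{H}(\omega^*)$ be its homeomorphism group with the compact-open topology, i.e. the topology with subbase all sets $[K,V]=\{f : f(K)\subseteq V\}$, $K\subseteq\omega^*$ compact, $V\subseteq\omega^*$ open. For a topological space $X$ let - $w(X)$ (weight) be the least cardinality of a base of $X$; - $\chi(X)$ (character) be the supremum over $x\in X$ of the least cardinality of a local base at $x$; - $\pi\chi(X)$ ($\pi$-character) be the supremum over $x\in X$ of the least cardinality of a local $\pi$-base at $x$, i.e. of a family of nonempty open sets such that every open neighbourhood of $x$ contains a member of the family; - $c(X)$ (cellularity) be the supremum of the cardinalities of pairwise disjoint families of nonempty open subsets of $X$; - $d(X)$ (density) be the least cardinality of a dense subset of $X$; - $t(X)$ (tightness) be the supremum over $x\in X$ of the least cardinal $\kappa$ such that whenever $x\in\overline{A}$ with $A\subseteq X$, there is $B\subseteq A$ with $|B|\le\kappa$ and $x\in\overline{B}$. Then (in ZFC) every nonempty open subset $U$ of $\mathcal{H}(\omega^*)$, with the subspace topology, satisfies $$w(U)=\chi(U)=\pi\chi(U)=c(U)=d(U)=t(U)=\mathfrak{c},$$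 where $\mathfrak{c}=2^{\aleph_0}$. -/

import Mathlib

open Set Topology
open scoped Cardinal

/-- The Čech–Stone remainder `X* = βX \ X`, with the subspace topology from `βX`. -/
abbrev StoneCechRemainder (X : Type) [TopologicalSpace X] : Type :=
  {p : StoneCech X // p ∉ range (stoneCechUnit : X → StoneCech X)}

/-- `ω*`, the Čech–Stone remainder of the countable discrete space. -/
abbrev OmegaStar : Type := StoneCechRemainder ℕ

/-- The compact-open topology on the homeomorphism group of `X`: the subspace topology inherited
from `C(X, X)`, so the sets `{f | f '' K ⊆ U}`, with `K` compact and `U` open, form a subbase. -/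
instance homeoCompactOpen (X : Type*) [TopologicalSpace X] : TopologicalSpace (X ≃ₜ X) :=
  TopologicalSpace.induced (fun f => (f : C(X, X))) ContinuousMap.compactOpen

namespace CardFn

universe u

/-- Weight: the least cardinality of a base. -/
noncomputable def weight (X : Type u) [TopologicalSpace X] : Cardinal.{u} :=
  sInf {κ | ∃ B : Set (Set X), TopologicalSpace.IsTopologicalBasis B ∧ #B = κ}

/-- `B` is a local base at `x`: a family of open neighbourhoods of `x` such that every open
neighbourhood of `x` contains a member of `B`. -/
def IsLocalBase {X : Type u} [TopologicalSpace X] (x : X) (B : Set (Set X)) : Prop :=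
  (∀ V ∈ B, IsOpen V ∧ x ∈ V) ∧ ∀ W : Set X, IsOpen W → x ∈ W → ∃ V ∈ B, V ⊆ W

/-- `B` is a local π-base at `x`: a family of nonempty open sets (not required to contain `x`)
such that every open neighbourhood of `x` contains a member of `B`. -/
def IsLocalPiBase {X : Type u} [TopologicalSpace X] (x : X) (B : Set (Set X)) : Prop :=
  (∀ V ∈ B, IsOpen V ∧ V.Nonempty) ∧ ∀ W : Set X, IsOpen W → x ∈ W → ∃ V ∈ B, V ⊆ W

/-- Character of the point `x`: the least cardinality of a local base at `x`. -/
noncomputable def characterAt {X : Type u} [TopologicalSpace X] (x : X) : Cardinal.{u} :=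
  sInf {κ | ∃ B : Set (Set X), IsLocalBase x B ∧ #B = κ}

/-- Character: the supremum of the characters of the points. -/
noncomputable def character (X : Type u) [TopologicalSpace X] : Cardinal.{u} :=
  ⨆ x : X, characterAt x

/-- π-character of the point `x`: the least cardinality of a local π-base at `x`. -/
noncomputable def piCharacterAt {X : Type u} [TopologicalSpace X] (x : X) : Cardinal.{u} :=
  sInf {κ | ∃ B : Set (Set X), IsLocalPiBase x B ∧ #B = κ}

/-- π-character: the supremum of the π-characters of the points. -/
noncomputable def piCharacter (X : Type u) [TopologicalSpace X] : Cardinal.{u} :=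
  ⨆ x : X, piCharacterAt x

/-- A cellular family: a pairwise disjoint family of nonempty open sets. -/
def IsCellular {X : Type u} [TopologicalSpace X] (B : Set (Set X)) : Prop :=
  (∀ V ∈ B, IsOpen V ∧ V.Nonempty) ∧ B.Pairwise Disjoint

/-- Cellularity: the supremum of the cardinalities of cellular families. -/
noncomputable def cellularity (X : Type u) [TopologicalSpace X] : Cardinal.{u} :=
  ⨆ B : {B : Set (Set X) // IsCellular B}, #B.1

/-- Density: the least cardinality of a dense subset. -/
noncomputable def density (X : Type u) [TopologicalSpace X] : Cardinal.{u} :=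
  sInf {κ | ∃ D : Set X, Dense D ∧ #D = κ}

/-- Tightness at `x`: the least `κ` such that whenever `x` is in the closure of a set `A`, it is
in the closure of a subset of `A` of cardinality at most `κ`. -/
noncomputable def tightnessAt {X : Type u} [TopologicalSpace X] (x : X) : Cardinal.{u} :=
  sInf {κ | ∀ A : Set X, x ∈ closure A → ∃ B ⊆ A, #B ≤ κ ∧ x ∈ closure B}

/-- Tightness: the supremum of the tightness at the points. -/
noncomputable def tightness (X : Type u) [TopologicalSpace X] : Cardinal.{u} :=
  ⨆ x : X, tightnessAt x

end CardFn

/-! All six invariants are at most the weight. Clopen subsets of `ω*` are the traces `A*`, with `A*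
= B*` iff `A` and `B` differ finitely, so there are exactly `𝔠` of them. By zero-dimensionality,
finitely many conditions `g '' A = C` with `A`, `C` clopen give basic open sets, hence weight at
most `𝔠`.

The lower bounds need elements of the stabilizer of a finite family `F` of clopen sets, and
permutations of `ω` preserving a finite colouring supply them. Flips inside an infinite colour class
move one clopen set to `𝔠` many others, giving `𝔠` disjoint open sets (`le_cellularity`); density
lies between cellularity and weight. Shifts on the infinite colour classes give a homeomorphism with
only finitely many invariant clopen sets (`hasFiniteInvariants_omegaStar`). A local π-base, or a set
witnessing tightness, of size below `𝔠` would then cover the `𝔠` clopen sets by fewer than `𝔠`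
finite sets (`le_piCharacterAt`, `le_tightnessAt`); character lies between π-character and weight.
-/

/-! ### General inequalities between the cardinal functions. -/

namespace CardFn

universe u

variable {X : Type u} [TopologicalSpace X]

theorem exists_basis_mk_eq_weight (X : Type u) [TopologicalSpace X] :
    ∃ B : Set (Set X), TopologicalSpace.IsTopologicalBasis B ∧ #B = weight X :=
  csInf_mem (s := {κ | ∃ B : Set (Set X), TopologicalSpace.IsTopologicalBasis B ∧ #B = κ})
    ⟨_, _, TopologicalSpace.isTopologicalBasis_opens, rfl⟩

theorem weight_le {B : Set (Set X)} (hB : TopologicalSpace.IsTopologicalBasis B) :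
    weight X ≤ #B :=
  csInf_le' ⟨B, hB, rfl⟩

theorem exists_isLocalBase_mk_eq (x : X) :
    ∃ B : Set (Set X), IsLocalBase x B ∧ #B = characterAt x :=
  csInf_mem (s := {κ | ∃ B : Set (Set X), IsLocalBase x B ∧ #B = κ})
    ⟨_, {V | IsOpen V ∧ x ∈ V}, ⟨fun _ h => h, fun W hW hx => ⟨W, ⟨hW, hx⟩, Subset.rfl⟩⟩, rfl⟩

theorem exists_isLocalPiBase_mk_eq (x : X) :
    ∃ B : Set (Set X), IsLocalPiBase x B ∧ #B = piCharacterAt x :=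
  csInf_mem (s := {κ | ∃ B : Set (Set X), IsLocalPiBase x B ∧ #B = κ})
    ⟨_, {V | IsOpen V ∧ V.Nonempty}, ⟨fun _ h => h, fun W hW hx =>
      ⟨W, ⟨hW, x, hx⟩, Subset.rfl⟩⟩, rfl⟩

theorem exists_dense_mk_eq_density (X : Type u) [TopologicalSpace X] :
    ∃ D : Set X, Dense D ∧ #D = density X :=
  csInf_mem (s := {κ | ∃ D : Set X, Dense D ∧ #D = κ}) ⟨_, univ, dense_univ, rfl⟩

theorem tightnessAt_spec (x : X) {A : Set X} (hA : x ∈ closure A) :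
    ∃ B ⊆ A, #B ≤ tightnessAt x ∧ x ∈ closure B :=
  csInf_mem (s := {κ | ∀ A : Set X, x ∈ closure A → ∃ B ⊆ A, #B ≤ κ ∧ x ∈ closure B})
    ⟨#X, fun A hA => ⟨A, Subset.rfl, Cardinal.mk_set_le A, hA⟩⟩ A hA

theorem characterAt_le_weight (x : X) : characterAt x ≤ weight X := by
  obtain ⟨B, hB, hcard⟩ := exists_basis_mk_eq_weight X
  have hloc : IsLocalBase x {V ∈ B | x ∈ V} := by
    refine ⟨fun V hV => ⟨hB.isOpen hV.1, hV.2⟩, fun W hW hx => ?_⟩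
    obtain ⟨V, hV, hxV, hVW⟩ := hB.exists_subset_of_mem_open hx hW
    exact ⟨V, ⟨hV, hxV⟩, hVW⟩
  have hle : characterAt x ≤ #{V ∈ B | x ∈ V} := csInf_le' ⟨_, hloc, rfl⟩
  exact hle.trans ((Cardinal.mk_le_mk_of_subset (sep_subset _ _)).trans hcard.le)

theorem piCharacterAt_le_characterAt (x : X) : piCharacterAt x ≤ characterAt x := by
  obtain ⟨B, hB, hcard⟩ := exists_isLocalBase_mk_eq x
  exact hcard ▸ csInf_le' ⟨B, ⟨fun V hV => ⟨(hB.1 V hV).1, x, (hB.1 V hV).2⟩, hB.2⟩, rfl⟩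

theorem tightnessAt_le_characterAt (x : X) : tightnessAt x ≤ characterAt x := by
  obtain ⟨B, hB, hcard⟩ := exists_isLocalBase_mk_eq x
  rw [← hcard]
  refine csInf_le' fun A hA => ?_
  have hmeet (V : B) : ∃ a, a ∈ V.1 ∩ A :=
    mem_closure_iff.1 hA V.1 (hB.1 V.1 V.2).1 (hB.1 V.1 V.2).2
  choose a ha using hmeet
  refine ⟨range a, ?_, Cardinal.mk_range_le, mem_closure_iff.2 fun W hW hx => ?_⟩
  · rintro _ ⟨V, rfl⟩
    exact (ha V).2
  · obtain ⟨V, hV, hVW⟩ := hB.2 W hW hx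
    exact ⟨a ⟨V, hV⟩, hVW (ha ⟨V, hV⟩).1, mem_range_self _⟩

theorem density_le_weight (X : Type u) [TopologicalSpace X] : density X ≤ weight X := by
  obtain ⟨B, hB, hcard⟩ := exists_basis_mk_eq_weight X
  rw [← hcard]
  let a : {V : B // V.1.Nonempty} → X := fun V => V.2.some
  have hle : density X ≤ #(range a) := by
    refine csInf_le' ⟨range a, hB.dense_iff.2 fun V hV hne => ?_, rfl⟩
    exact ⟨a ⟨⟨V, hV⟩, hne⟩, hne.some_mem, mem_range_self _⟩
  exact hle.trans (Cardinal.mk_range_le.trans (Cardinal.mk_subtype_le _))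

theorem mk_cellular_le_density {B : Set (Set X)} (hB : IsCellular B) : #B ≤ density X := by
  obtain ⟨D, hD, hcard⟩ := exists_dense_mk_eq_density X
  rw [← hcard]
  have hmeet (V : B) : ∃ a, a ∈ V.1 ∩ D :=
    hD.inter_open_nonempty V.1 (hB.1 V.1 V.2).1 (hB.1 V.1 V.2).2
  choose a ha using hmeet
  refine Cardinal.mk_le_of_injective (f := fun V => (⟨a V, (ha V).2⟩ : D)) fun V W h => ?_
  by_contra hne
  have h' : a V = a W := congrArg Subtype.val h
  exact disjoint_left.1 (hB.2 V.2 W.2 fun e => hne (Subtype.ext e)) (ha V).1 (h' ▸ (ha W).1)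

theorem cellularity_le_density (X : Type u) [TopologicalSpace X] :
    cellularity X ≤ density X :=
  ciSup_le' fun B => mk_cellular_le_density B.2

theorem mk_le_cellularity {B : Set (Set X)} (hB : IsCellular B) : #B ≤ cellularity X :=
  le_ciSup (f := fun B : {B : Set (Set X) // IsCellular B} => #B.1)
    Cardinal.bddAbove_of_small ⟨B, hB⟩

theorem characterAt_le_character (x : X) : characterAt x ≤ character X :=
  le_ciSup (f := fun x : X => characterAt x) Cardinal.bddAbove_of_small x

theorem piCharacterAt_le_piCharacter (x : X) : piCharacterAt x ≤ piCharacter X :=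
  le_ciSup (f := fun x : X => piCharacterAt x) Cardinal.bddAbove_of_small x

theorem tightnessAt_le_tightness (x : X) : tightnessAt x ≤ tightness X :=
  le_ciSup (f := fun x : X => tightnessAt x) Cardinal.bddAbove_of_small x

theorem character_le_weight (X : Type u) [TopologicalSpace X] : character X ≤ weight X :=
  ciSup_le' characterAt_le_weight

theorem piCharacter_le_character (X : Type u) [TopologicalSpace X] :
    piCharacter X ≤ character X :=
  ciSup_le' fun x => (piCharacterAt_le_characterAt x).trans (characterAt_le_character x)

theorem tightness_le_character (X : Type u) [TopologicalSpace X] : tightness X ≤ character X :=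
  ciSup_le' fun x => (tightnessAt_le_characterAt x).trans (characterAt_le_character x)

end CardFn

/-! ### Homeomorphism groups of zero-dimensional compact spaces. -/

section Homeo

variable {X : Type} [TopologicalSpace X]

theorem isClopen_homeo_image (g : X ≃ₜ X) {A : Set X} (hA : IsClopen A) : IsClopen (g '' A) :=
  ⟨g.isClosed_image.2 hA.isClosed, g.isOpen_image.2 hA.isOpen⟩

theorem image_trans_eq_iff (h g : X ≃ₜ X) (A B : Set X) :
    (h.trans g) '' A = g '' B ↔ h '' A = B := by
  rw [show ⇑(h.trans g) = g ∘ h from rfl, image_comp, g.injective.image_injective.eq_iff]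

theorem continuous_homeo_toContinuousMap :
    Continuous (fun f : X ≃ₜ X => (f : C(X, X))) :=
  continuous_induced_dom

theorem isOpen_setOf_homeo_image_subset {K V : Set X} (hK : IsCompact K) (hV : IsOpen V) :
    IsOpen {g : X ≃ₜ X | g '' K ⊆ V} := by
  convert (ContinuousMap.isOpen_setOfPred_mapsTo hK hV).preimage
    (continuous_homeo_toContinuousMap (X := X)) using 1
  ext g
  exact image_subset_iff

theorem isOpen_setOf_homeo_image_eq [CompactSpace X] {A C : Set X} (hA : IsClopen A)
    (hC : IsClopen C) : IsOpen {g : X ≃ₜ X | g '' A = C} := by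
  convert (isOpen_setOf_homeo_image_subset hA.isClosed.isCompact hC.isOpen).inter
    (isOpen_setOf_homeo_image_subset hA.compl.isClosed.isCompact hC.compl.isOpen) using 1
  ext g
  simp only [mem_ofPred_eq, mem_inter_iff, image_compl_eq g.bijective, compl_subset_compl]
  exact subset_antisymm_iff

/-- The homeomorphisms that agree with `f` on the members of `F`. -/
def homeoAgree (f : X ≃ₜ X) (F : Set (Set X)) : Set (X ≃ₜ X) :=
  {g | ∀ A ∈ F, g '' A = f '' A}

/-- Zero-dimensionality puts a clopen `A` between `K` and the preimage of `V` under `f`; any `g`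
with `g '' A = f '' A` then sends `K` into `V`. -/
theorem exists_homeoAgree_subset [CompactSpace X] [T2Space X] [TotallyDisconnectedSpace X]
    {f : X ≃ₜ X} {U : Set (X ≃ₜ X)} (hU : IsOpen U) (hf : f ∈ U) :
    ∃ F : Set (Set X), F.Finite ∧ (∀ A ∈ F, IsClopen A) ∧ homeoAgree f F ⊆ U := by
  have hgen : homeoCompactOpen X = TopologicalSpace.generateFrom
      {W | ∃ K V : Set X, IsCompact K ∧ IsOpen V ∧ W = {g : X ≃ₜ X | g '' K ⊆ V}} := by
    rw [homeoCompactOpen, ContinuousMap.compactOpen_eq, induced_generateFrom_eq]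
    congr 1
    ext W
    constructor
    · rintro ⟨_, ⟨K, hK, V, hV, rfl⟩, rfl⟩
      refine ⟨K, V, hK, hV, ?_⟩
      ext g
      exact image_subset_iff.symm
    · rintro ⟨K, V, hK, hV, rfl⟩
      refine ⟨_, ⟨K, hK, V, hV, rfl⟩, ?_⟩
      ext g
      exact image_subset_iff.symm
  rw [hgen] at hU
  induction hU with
  | basic W hW =>
    obtain ⟨K, V, hK, hV, rfl⟩ := hW
    obtain ⟨A, hA, hKA, hAV⟩ := exists_clopen_of_closed_subset_open hK.isClosed
      (hV.preimage f.continuous) (image_subset_iff.1 hf)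
    refine ⟨{A}, finite_singleton _, by simpa using hA, fun g hg => ?_⟩
    have := hg A rfl
    exact (image_mono hKA).trans (this ▸ image_subset_iff.2 hAV)
  | univ => exact ⟨∅, finite_empty, by simp, subset_univ _⟩
  | inter S T _ _ hS hT =>
    obtain ⟨F, hF, hFc, hFS⟩ := hS hf.1
    obtain ⟨G, hG, hGc, hGT⟩ := hT hf.2
    exact ⟨F ∪ G, hF.union hG, fun A hA => hA.elim (hFc A) (hGc A), fun g hg =>
      ⟨hFS fun A hA => hg A (Or.inl hA), hGT fun A hA => hg A (Or.inr hA)⟩⟩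
  | sUnion S _ hS =>
    obtain ⟨T, hT, hfT⟩ := hf
    obtain ⟨F, hF, hFc, hFT⟩ := hS T hT hfT
    exact ⟨F, hF, hFc, hFT.trans (subset_sUnion_of_mem hT)⟩

theorem weight_le_mk_isClopen [CompactSpace X] [T2Space X] [TotallyDisconnectedSpace X]
    [Infinite {A : Set X // IsClopen A}] (U : Set (X ≃ₜ X)) :
    CardFn.weight U ≤ #{A : Set X // IsClopen A} := by
  -- Recording source and target makes the base independent of `f`, so it is indexed by finite sets
  -- of pairs of clopen sets.
  let P := {A : Set X // IsClopen A} × {A : Set X // IsClopen A}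
  let N : Finset P → Set (X ≃ₜ X) := fun F => {g | ∀ p ∈ F, g '' p.1.1 = p.2.1}
  have hN : TopologicalSpace.IsTopologicalBasis (range N) := by
    refine TopologicalSpace.isTopologicalBasis_of_isOpen_of_nhds ?_ fun f W hf hW => ?_
    · rintro _ ⟨F, rfl⟩
      have : N F = ⋂ p ∈ F, {g : X ≃ₜ X | g '' p.1.1 = p.2.1} := by
        ext g; simp [N]
      rw [this]
      exact isOpen_biInter_finset fun p _ => isOpen_setOf_homeo_image_eq p.1.2 p.2.2
    · obtain ⟨F, hF, hFc, hFW⟩ := exists_homeoAgree_subset hW hf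
      have : Finite F := hF
      have hfin : (range fun A : F => ((⟨A.1, hFc A.1 A.2⟩,
        ⟨f '' A.1, isClopen_homeo_image f (hFc A.1 A.2)⟩) : P)).Finite := finite_range _
      refine ⟨N hfin.toFinset, mem_range_self _, ?_, fun g hg => hFW fun A hA => ?_⟩
      · intro p hp
        obtain ⟨A, rfl⟩ := hfin.mem_toFinset.1 hp
        rfl
      · exact hg _ (hfin.mem_toFinset.2 ⟨⟨A, hA⟩, rfl⟩)
  have hU := hN.induced (Subtype.val : U → X ≃ₜ X)
  refine (CardFn.weight_le hU).trans (Cardinal.mk_image_le.trans (Cardinal.mk_range_le.trans ?_))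
  have hinf : ℵ₀ ≤ #{A : Set X // IsClopen A} := Cardinal.aleph0_le_mk _
  rw [Cardinal.mk_finset_of_infinite, ← Cardinal.mul_def, Cardinal.mul_eq_self hinf]

/-- The uniform bound `#ι * ℵ₀` makes regularity of `κ` unnecessary. -/
theorem mk_iUnion_finite_lt {ι α : Type} (s : ι → Set α) (hs : ∀ i, (s i).Finite)
    {κ : Cardinal} (hκ : ℵ₀ < κ) (hι : #ι < κ) : #(⋃ i, s i) < κ := by
  refine (Cardinal.mk_iUnion_le s).trans_lt ((mul_le_mul' le_rfl (ciSup_le' fun i =>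
    ((hs i).lt_aleph0).le)).trans_lt (Cardinal.mul_lt_of_lt hκ.le hι hκ))

/-- Every stabilizer of finitely many clopen sets contains a homeomorphism that leaves only
finitely many clopen sets invariant. -/
def HasFiniteInvariants (X : Type) [TopologicalSpace X] : Prop :=
  ∀ F : Set (Set X), F.Finite → (∀ A ∈ F, IsClopen A) →
    ∃ h : X ≃ₜ X, (∀ A ∈ F, h '' A = A) ∧ {C : Set X | IsClopen C ∧ h '' C = C}.Finite

variable [CompactSpace X] [T2Space X] [TotallyDisconnectedSpace X]

/-- Each member of the π-base contains some `g` and `g ∘ h`, where `h` has finitely many invariant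
clopen sets. A member contained in `{k | k '' A = f '' A}` forces `A` to be invariant under its `h`,
so these finite families cover all clopen sets. -/
theorem le_piCharacterAt {κ : Cardinal} (hκ : ℵ₀ < κ) (hcl : κ ≤ #{A : Set X | IsClopen A})
    (hfin : HasFiniteInvariants X) {U : Set (X ≃ₜ X)} (hU : IsOpen U) (f : U) :
    κ ≤ CardFn.piCharacterAt f := by
  by_contra! hlt
  obtain ⟨B, hB, hcard⟩ := CardFn.exists_isLocalPiBase_mk_eq f
  rw [← hcard] at hlt
  have key (V : B) : ∃ g : X ≃ₜ X, ∃ h : X ≃ₜ X, (∃ hg : g ∈ U, (⟨g, hg⟩ : U) ∈ V.1) ∧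
      (∃ hg : h.trans g ∈ U, (⟨h.trans g, hg⟩ : U) ∈ V.1) ∧
      {C : Set X | IsClopen C ∧ h '' C = C}.Finite := by
    obtain ⟨hVo, ⟨g, hgU⟩, hgV⟩ := hB.1 V.1 V.2
    obtain ⟨F, hF, hFc, hFV⟩ := exists_homeoAgree_subset (hU.isOpenMap_subtype_val _ hVo)
      (mem_image_of_mem _ hgV)
    obtain ⟨h, hh, hfi⟩ := hfin F hF hFc
    obtain ⟨⟨g', hg'⟩, hg'V, rfl⟩ := hFV (show h.trans g ∈ homeoAgree g F from
      fun A hA => (image_trans_eq_iff _ _ _ _).2 (hh A hA))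
    exact ⟨g, h, ⟨hgU, hgV⟩, ⟨hg', hg'V⟩, hfi⟩
  choose g h hg hgh hfi using key
  refine (hcl.trans (Cardinal.mk_le_mk_of_subset ?_)).not_gt (mk_iUnion_finite_lt _ hfi hκ hlt)
  intro A hA
  obtain ⟨V, hV, hVW⟩ := hB.2 (Subtype.val ⁻¹' {k : X ≃ₜ X | k '' A = f.1 '' A})
    ((isOpen_setOf_homeo_image_eq hA (isClopen_homeo_image f.1 hA)).preimage continuous_subtype_val)
    rfl
  obtain ⟨_, h1⟩ := hg ⟨V, hV⟩
  obtain ⟨_, h2⟩ := hgh ⟨V, hV⟩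
  have e1 : g ⟨V, hV⟩ '' A = f.1 '' A := hVW h1
  have e2 : (h ⟨V, hV⟩).trans (g ⟨V, hV⟩) '' A = f.1 '' A := hVW h2
  rw [← e1, image_trans_eq_iff] at e2
  exact mem_iUnion.2 ⟨⟨V, hV⟩, hA, e2⟩

theorem le_tightnessAt {κ : Cardinal} (hκ : ℵ₀ < κ) (hcl : κ ≤ #{A : Set X | IsClopen A})
    (hfin : HasFiniteInvariants X) {U : Set (X ≃ₜ X)} (hU : IsOpen U) (f : U) :
    κ ≤ CardFn.tightnessAt f := by
  by_contra! hlt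
  -- A subset of `S` having `f` in its closure must, for each clopen `A`, contain a member agreeing
  -- with `f` on `A`.
  let S : Set U := {g | {C : Set X | IsClopen C ∧ g.1 '' C = f.1 '' C}.Finite}
  have hS : f ∈ closure S := by
    refine mem_closure_iff.2 fun W hW hfW => ?_
    obtain ⟨F, hF, hFc, hFW⟩ := exists_homeoAgree_subset (hU.isOpenMap_subtype_val _ hW)
      (mem_image_of_mem _ hfW)
    obtain ⟨h, hh, hfi⟩ := hfin F hF hFc
    obtain ⟨g, hgW, hg⟩ := hFW (show h.trans f.1 ∈ homeoAgree f.1 F from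
      fun A hA => (image_trans_eq_iff _ _ _ _).2 (hh A hA))
    refine ⟨g, hgW, ?_⟩
    simpa only [S, mem_ofPred_eq, hg, image_trans_eq_iff] using hfi
  obtain ⟨B, hBS, hB, hfB⟩ := CardFn.tightnessAt_spec f hS
  refine (hcl.trans (Cardinal.mk_le_mk_of_subset ?_)).not_gt
    (mk_iUnion_finite_lt (fun b : B => {C : Set X | IsClopen C ∧ b.1.1 '' C = f.1 '' C})
      (fun b => hBS b.2) hκ (hB.trans_lt hlt))
  intro A hA
  obtain ⟨b, hb, hbB⟩ := mem_closure_iff.1 hfB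
    (Subtype.val ⁻¹' {k : X ≃ₜ X | k '' A = f.1 '' A})
    ((isOpen_setOf_homeo_image_eq hA (isClopen_homeo_image f.1 hA)).preimage continuous_subtype_val)
    rfl
  exact mem_iUnion.2 ⟨⟨b, hbB⟩, hA, hb⟩

theorem le_cellularity {κ : Cardinal}
    (horb : ∀ F : Set (Set X), F.Finite → (∀ A ∈ F, IsClopen A) → ∃ A : Set X, IsClopen A ∧
      κ ≤ #{C : Set X | ∃ h : X ≃ₜ X, (∀ B ∈ F, h '' B = B) ∧ h '' A = C})
    {U : Set (X ≃ₜ X)} (hU : IsOpen U) (hne : U.Nonempty) : κ ≤ CardFn.cellularity U := by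
  obtain ⟨f, hf⟩ := hne
  obtain ⟨F, hF, hFc, hFU⟩ := exists_homeoAgree_subset hU hf
  obtain ⟨A, hA, hκ⟩ := horb F hF hFc
  let O := {C : Set X | ∃ h : X ≃ₜ X, (∀ B ∈ F, h '' B = B) ∧ h '' A = C}
  -- These sets are disjoint because `g` determines `g '' A`, hence `C`.
  let V : O → Set U := fun C => Subtype.val ⁻¹' {g : X ≃ₜ X | g '' A = f '' C.1}
  have hVo (C : O) : IsOpen (V C) := by
    obtain ⟨_, h, -, rfl⟩ := C
    exact (isOpen_setOf_homeo_image_eq hA (isClopen_homeo_image f (isClopen_homeo_image h hA))).preimage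
      continuous_subtype_val
  have hVne (C : O) : (V C).Nonempty := by
    obtain ⟨_, h, hh, rfl⟩ := C
    exact ⟨⟨h.trans f, hFU fun B hB => (image_trans_eq_iff _ _ _ _).2 (hh B hB)⟩,
      (image_trans_eq_iff _ _ _ _).2 rfl⟩
  have hVeq {C D : O} {g : U} (hC : g ∈ V C) (hD : g ∈ V D) : C = D :=
    Subtype.ext (f.injective.image_injective (Eq.trans (Eq.symm hC) hD))
  have hinj : Function.Injective V := fun C D h => by
    obtain ⟨g, hg⟩ := hVne C
    exact hVeq hg (h ▸ hg)
  have hcell : CardFn.IsCellular (range V) := by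
    refine ⟨?_, ?_⟩
    · rintro _ ⟨C, rfl⟩
      exact ⟨hVo C, hVne C⟩
    · rintro _ ⟨C, rfl⟩ _ ⟨D, rfl⟩ hCD
      exact disjoint_left.2 fun g hC hD => hCD (congrArg V (hVeq hC hD))
  exact (hκ.trans (Cardinal.mk_range_eq V hinj).ge).trans (CardFn.mk_le_cellularity hcell)

end Homeo

/-! ### Clopen subsets of `βω` and `ω*`, and homeomorphisms induced by permutations. -/

section StoneCechNat

theorem exists_isClopen_preimage_stoneCechUnit (A : Set ℕ) :
    ∃ K : Set (StoneCech ℕ), IsClopen K ∧ stoneCechUnit ⁻¹' K = A := by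
  classical
  have hc : Continuous (fun n => decide (n ∈ A) : ℕ → Bool) := continuous_of_discreteTopology
  refine ⟨stoneCechExtend hc ⁻¹' {true},
    (isClopen_discrete _).preimage (continuous_stoneCechExtend hc), ?_⟩
  ext n
  simp

theorem closure_image_preimage_stoneCechUnit {K : Set (StoneCech ℕ)} (hK : IsClopen K) :
    closure (stoneCechUnit '' (stoneCechUnit ⁻¹' K)) = K := by
  rw [image_preimage_eq_inter_range]
  exact ((closure_mono inter_subset_left).trans hK.isClosed.closure_subset).antisymm
    (denseRange_stoneCechUnit.open_subset_closure_inter hK.isOpen)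

theorem isClopen_closure_stoneCechUnit (A : Set ℕ) :
    IsClopen (closure (stoneCechUnit '' A)) := by
  obtain ⟨K, hK, rfl⟩ := exists_isClopen_preimage_stoneCechUnit A
  rwa [closure_image_preimage_stoneCechUnit hK]

theorem preimage_closure_stoneCechUnit (A : Set ℕ) :
    stoneCechUnit ⁻¹' closure (stoneCechUnit '' A) = A := by
  obtain ⟨K, hK, rfl⟩ := exists_isClopen_preimage_stoneCechUnit A
  rw [closure_image_preimage_stoneCechUnit hK]

instance totallySeparatedSpace_stoneCechNat : TotallySeparatedSpace (StoneCech ℕ) := by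
  refine totallySeparatedSpace_iff_exists_isClopen.2 fun p q hpq => ?_
  obtain ⟨V, W, hV, hW, hpV, hqW, hVW⟩ := t2_separation hpq
  refine ⟨closure (stoneCechUnit '' (stoneCechUnit ⁻¹' V)),
    isClopen_closure_stoneCechUnit _, ?_, ?_⟩
  · rw [image_preimage_eq_inter_range]
    exact denseRange_stoneCechUnit.open_subset_closure_inter hV hpV
  · intro hq
    obtain ⟨_, hxW, n, hn, rfl⟩ := mem_closure_iff.1 hq W hW hqW
    exact disjoint_left.1 hVW hn hxW

theorem isOpen_range_stoneCechUnit_nat : IsOpen (range (stoneCechUnit : ℕ → StoneCech ℕ)) := by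
  have : range (stoneCechUnit : ℕ → StoneCech ℕ) = ⋃ n, closure (stoneCechUnit '' {n}) := by
    ext x
    simp [eq_comm]
  rw [this]
  exact isOpen_iUnion fun n => (isClopen_closure_stoneCechUnit {n}).isOpen

theorem isClosedEmbedding_omegaStar :
    IsClosedEmbedding (Subtype.val : OmegaStar → StoneCech ℕ) :=
  isOpen_range_stoneCechUnit_nat.isClosed_compl.isClosedEmbedding_subtypeVal

instance compactSpace_omegaStar : CompactSpace OmegaStar :=
  isClosedEmbedding_omegaStar.compactSpace

theorem exists_omegaStar_mem_iff_infinite {K : Set (StoneCech ℕ)} (hK : IsClopen K) :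
    (∃ p : OmegaStar, p.1 ∈ K) ↔ (stoneCechUnit ⁻¹' K).Infinite := by
  constructor
  · rintro ⟨p, hp⟩ hfin
    rw [← closure_image_preimage_stoneCechUnit hK, (hfin.image _).isClosed.closure_eq] at hp
    exact p.2 (image_subset_range _ _ hp)
  · intro hinf
    -- Otherwise `K` would be a compact subset of the discrete copy of `ω`, hence finite.
    by_contra! hno
    have hsub : K ⊆ range stoneCechUnit := fun x hx => by
      by_contra hxr
      exact hno ⟨x, hxr⟩ hx
    refine hinf ?_
    rw [← isCompact_iff_finite, isEmbedding_stoneCechUnit.isInducing.isCompact_iff,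
      image_preimage_eq_of_subset hsub]
    exact hK.isClosed.isCompact

/-- The trace `A* = cl_{βω} A ∩ ω*` on `ω*` of a set of natural numbers. -/
def starSet (A : Set ℕ) : Set OmegaStar :=
  Subtype.val ⁻¹' closure (stoneCechUnit '' A)

/-- Two sets are almost equal if they differ in finitely many points only. -/
def AlmostEq {T : Type*} (A B : Set T) : Prop :=
  ∀ᶠ n in Filter.cofinite, (n ∈ A ↔ n ∈ B)

theorem isClopen_starSet (A : Set ℕ) : IsClopen (starSet A) :=
  (isClopen_closure_stoneCechUnit A).preimage continuous_subtype_val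

/-- Since `ω*` is closed in `βω`, `C` and its complement are disjoint closed sets of `βω`, so a
clopen subset of `βω` separates them. -/
theorem exists_starSet_eq {C : Set OmegaStar} (hC : IsClopen C) : ∃ A, starSet A = C := by
  have hCc := isClosedEmbedding_omegaStar.isClosedMap C hC.isClosed
  have hCo := (isClosedEmbedding_omegaStar.isClosedMap Cᶜ hC.compl.isClosed).isOpen_compl
  obtain ⟨K, hK, hCK, hKC⟩ := exists_clopen_of_closed_subset_open hCc hCo (by
    rintro _ ⟨p, hp, rfl⟩ ⟨q, hq, e⟩
    exact hq (Subtype.ext e ▸ hp))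
  refine ⟨stoneCechUnit ⁻¹' K, ?_⟩
  rw [starSet, closure_image_preimage_stoneCechUnit hK]
  ext p
  refine ⟨fun hp => ?_, fun hp => hCK ⟨p, hp, rfl⟩⟩
  by_contra hpC
  exact hKC hp ⟨p, hpC, rfl⟩

theorem starSet_eq_iff {A B : Set ℕ} : starSet A = starSet B ↔ AlmostEq A B := by
  have hA := isClopen_closure_stoneCechUnit A
  have hB := isClopen_closure_stoneCechUnit B
  have key := exists_omegaStar_mem_iff_infinite ((hA.diff hB).union (hB.diff hA))
  rw [preimage_union, preimage_sdiff, preimage_sdiff, preimage_closure_stoneCechUnit,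
    preimage_closure_stoneCechUnit] at key
  have hset : {n | ¬(n ∈ A ↔ n ∈ B)} = A \ B ∪ B \ A := by
    ext n
    simp only [mem_ofPred_eq, mem_union, mem_sdiff]
    tauto
  rw [AlmostEq, Filter.eventually_cofinite, hset, ← not_infinite, ← key, Set.ext_iff]
  simp only [starSet, mem_preimage, mem_union, mem_sdiff, not_exists]
  exact forall_congr' fun p => by tauto

/-- The map of `βω` induced by a self-map of `ω`. -/
noncomputable def stoneCechNatMap (s : ℕ → ℕ) : StoneCech ℕ → StoneCech ℕ :=
  stoneCechExtend (g := stoneCechUnit ∘ s) continuous_of_discreteTopology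

theorem continuous_stoneCechNatMap (s : ℕ → ℕ) : Continuous (stoneCechNatMap s) :=
  continuous_stoneCechExtend _

theorem stoneCechNatMap_unit (s : ℕ → ℕ) (n : ℕ) :
    stoneCechNatMap s (stoneCechUnit n) = stoneCechUnit (s n) :=
  stoneCechExtend_stoneCechUnit _ n

theorem leftInverse_stoneCechNatMap {s t : ℕ → ℕ} (h : Function.LeftInverse s t) :
    Function.LeftInverse (stoneCechNatMap s) (stoneCechNatMap t) := by
  refine congrFun (Continuous.ext_on denseRange_stoneCechUnit
    ((continuous_stoneCechNatMap s).comp (continuous_stoneCechNatMap t)) continuous_id ?_)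
  rintro _ ⟨n, rfl⟩
  simp [stoneCechNatMap_unit, h n]

/-- The homeomorphism of `βω` induced by a permutation of `ω`. -/
noncomputable def stoneCechNatHomeo (σ : Equiv.Perm ℕ) : StoneCech ℕ ≃ₜ StoneCech ℕ where
  toFun := stoneCechNatMap σ
  invFun := stoneCechNatMap σ.symm
  left_inv := leftInverse_stoneCechNatMap σ.left_inv
  right_inv := leftInverse_stoneCechNatMap σ.right_inv
  continuous_toFun := continuous_stoneCechNatMap _
  continuous_invFun := continuous_stoneCechNatMap _

theorem stoneCechNatHomeo_mem_range (σ : Equiv.Perm ℕ) (p : StoneCech ℕ) :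
    p ∉ range (stoneCechUnit : ℕ → StoneCech ℕ) ↔
      stoneCechNatHomeo σ p ∉ range (stoneCechUnit : ℕ → StoneCech ℕ) := by
  refine not_congr ⟨?_, ?_⟩
  · rintro ⟨n, rfl⟩
    exact ⟨σ n, (stoneCechNatMap_unit σ n).symm⟩
  · rintro ⟨n, hn⟩
    refine ⟨σ.symm n, (stoneCechNatHomeo σ).injective ?_⟩
    rw [← hn]
    exact (stoneCechNatMap_unit σ _).trans (by simp)

/-- The homeomorphism of `ω*` induced by a permutation of `ω`. -/
noncomputable def omegaStarHomeo (σ : Equiv.Perm ℕ) : OmegaStar ≃ₜ OmegaStar :=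
  (stoneCechNatHomeo σ).subtype (stoneCechNatHomeo_mem_range σ)

theorem omegaStarHomeo_image_starSet (σ : Equiv.Perm ℕ) (A : Set ℕ) :
    omegaStarHomeo σ '' starSet A = starSet (σ '' A) := by
  have himg : stoneCechNatHomeo σ '' closure (stoneCechUnit '' A) =
      closure (stoneCechUnit '' (σ '' A)) := by
    rw [(stoneCechNatHomeo σ).image_closure, image_image, image_image]
    congr 1
    exact image_congr fun n _ => stoneCechNatMap_unit σ n
  ext q
  obtain ⟨p, rfl⟩ := (omegaStarHomeo σ).surjective q
  rw [(omegaStarHomeo σ).injective.mem_set_image, starSet, starSet, mem_preimage, mem_preimage,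
    ← himg]
  exact ((stoneCechNatHomeo σ).injective.mem_set_image (a := p.1)).symm

end StoneCechNat

/-! ### Combinatorics of permutations of `ω` modulo finite sets. -/

section AlmostEq

variable {T S : Type*}

theorem AlmostEq.symm {A B : Set T} (h : AlmostEq A B) : AlmostEq B A :=
  h.mono fun _ => Iff.symm

theorem AlmostEq.trans {A B C : Set T} (h : AlmostEq A B) (h' : AlmostEq B C) : AlmostEq A C := by
  filter_upwards [h, h'] with n h₁ h₂ using h₁.trans h₂

theorem AlmostEq.preimage {A B : Set T} (h : AlmostEq A B) {e : S → T}
    (he : Function.Injective e) : AlmostEq (e ⁻¹' A) (e ⁻¹' B) :=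
  he.tendsto_cofinite.eventually h

theorem countable_setOf_almostEq (D : Set ℕ) : {E : Set ℕ | AlmostEq E D}.Countable := by
  have hfin : {s : Set ℕ | s.Finite}.Countable := Set.Countable.ofPred_finite
  refine (hfin.image fun s => symmDiff s D).mono fun E hE => ?_
  refine ⟨symmDiff E D, ?_, symmDiff_symmDiff_cancel_right D E⟩
  refine (Filter.eventually_cofinite.1 hE).subset fun n hn => ?_
  simp only [mem_symmDiff] at hn
  simp only [mem_ofPred_eq]
  tauto

/-- The fibres of `φ` lie in almost-equality classes, which are countable. -/
theorem continuum_le_mk_range {β : Type} (φ : Set ℕ → β)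
    (hφ : ∀ D E, φ D = φ E → AlmostEq D E) : 𝔠 ≤ #(range φ) := by
  have hle : #(Set ℕ) ≤ #(range φ) * ℵ₀ := by
    refine Cardinal.mk_le_mk_mul_of_mk_preimage_le (rangeFactorization φ) ?_
    rintro ⟨_, D, rfl⟩
    refine Cardinal.mk_le_aleph0_iff.2 (Set.countable_coe_iff.2 ?_)
    exact (countable_setOf_almostEq D).mono fun E hE => hφ E D (congrArg Subtype.val hE)
  rw [Cardinal.mk_set, Cardinal.mk_nat, Cardinal.two_power_aleph0] at hle
  by_contra! hlt
  exact hle.not_gt (Cardinal.mul_lt_of_lt Cardinal.aleph0_le_continuum hlt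
    Cardinal.aleph0_lt_continuum)

/-- The permutation `τ` has, up to almost equality, only finitely many almost invariant sets. -/
def FewAlmostInvariant (τ : Equiv.Perm T) : Prop :=
  ∃ G : Set (Set T), G.Finite ∧ ∀ D, AlmostEq (τ ⁻¹' D) D → ∃ D' ∈ G, AlmostEq D D'

/-- A set almost invariant under the shift is constant near `+∞` and near `-∞`, leaving four
possibilities modulo finite sets. -/
theorem fewAlmostInvariant_int : FewAlmostInvariant (Equiv.addRight (1 : ℤ)) := by
  let G : Prop × Prop → Set ℤ := fun p => {n | (0 ≤ n ∧ p.1) ∨ (n < 0 ∧ p.2)}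
  refine ⟨range G, finite_range G, fun D hD => ?_⟩
  rw [AlmostEq, Int.cofinite_eq, Filter.eventually_sup] at hD
  obtain ⟨N, hN⟩ := Filter.eventually_atTop.1 hD.2
  obtain ⟨M, hM⟩ := Filter.eventually_atBot.1 hD.1
  have hup (n : ℤ) (hn : N ≤ n) : n ∈ D ↔ N ∈ D := by
    induction n, hn using Int.leInduction with
    | base => rfl
    | succ n hn ih => exact (hN n hn).trans ih
  have hdown (n : ℤ) (hn : n ≤ M) : n ∈ D ↔ M ∈ D := by
    induction n, hn using Int.leInductionDown with
    | base => rfl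
    | pred n hn ih =>
      refine Iff.trans ?_ ih
      have := hM (n - 1) (by omega)
      simpa using this.symm
  refine ⟨G (N ∈ D, M ∈ D), mem_range_self _, ?_⟩
  rw [AlmostEq, Int.cofinite_eq, Filter.eventually_sup]
  constructor
  · filter_upwards [Filter.eventually_le_atBot M, Filter.eventually_lt_atBot 0] with n h₁ h₂
    simp [G, hdown n h₁, h₂, h₂.not_ge]
  · filter_upwards [Filter.eventually_ge_atTop N, Filter.eventually_ge_atTop 0] with n h₁ h₂
    simp [G, hup n h₁, h₂, h₂.not_gt]

theorem exists_fewAlmostInvariant (T : Type) [Countable T] :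
    ∃ τ : Equiv.Perm T, FewAlmostInvariant τ := by
  cases finite_or_infinite T with
  | inl h =>
    refine ⟨1, {∅}, finite_singleton _, fun D _ => ⟨∅, rfl, ?_⟩⟩
    simp [AlmostEq, Filter.cofinite_eq_bot]
  | inr h =>
    obtain ⟨e⟩ := nonempty_equiv_of_countable (α := T) (β := ℤ)
    obtain ⟨G, hG, hGD⟩ := fewAlmostInvariant_int
    refine ⟨(e.trans (Equiv.addRight 1)).trans e.symm, (e ⁻¹' ·) '' G, hG.image _,
      fun D hD => ?_⟩
    obtain ⟨D', hD', hDD'⟩ := hGD (e.symm ⁻¹' D) (by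
      have := hD.preimage e.symm.injective
      simpa [preimage_preimage, AlmostEq] using this)
    refine ⟨_, mem_image_of_mem _ hD', ?_⟩
    have := hDD'.preimage e.injective
    simpa [AlmostEq] using this

theorem almostEq_sigma {Y : Type} [Finite Y] {T : Y → Type} {A B : Set (Σ y, T y)}
    (h : ∀ y, AlmostEq (Sigma.mk y ⁻¹' A) (Sigma.mk y ⁻¹' B)) : AlmostEq A B := by
  rw [AlmostEq, Filter.eventually_cofinite]
  refine (finite_iUnion fun y => (Filter.eventually_cofinite.1 (h y)).image (Sigma.mk y)).subset ?_
  rintro ⟨y, t⟩ ht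
  exact mem_iUnion.2 ⟨y, t, ht, rfl⟩

/-- An almost invariant set is almost invariant on each summand; finitely many finite errors add up
to a finite error. -/
theorem FewAlmostInvariant.sigma {Y : Type} [Finite Y] {T : Y → Type}
    {τ : ∀ y, Equiv.Perm (T y)} (hτ : ∀ y, FewAlmostInvariant (τ y)) :
    FewAlmostInvariant (Equiv.sigmaCongrRight τ) := by
  choose G hG hGD using hτ
  refine ⟨(fun E : ∀ y, Set (T y) => {p : Σ y, T y | p.2 ∈ E p.1}) '' univ.pi G,
    (Finite.pi hG).image _, fun D hD => ?_⟩
  have hy (y : Y) : ∃ D' ∈ G y, AlmostEq (Sigma.mk y ⁻¹' D) D' :=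
    hGD y _ (hD.preimage sigma_mk_injective)
  choose D' hD' hDD' using hy
  exact ⟨_, ⟨D', fun y _ => hD' y, rfl⟩, almostEq_sigma hDD'⟩

theorem FewAlmostInvariant.conj {τ : Equiv.Perm T} (hτ : FewAlmostInvariant τ) (e : T ≃ S) :
    FewAlmostInvariant ((e.symm.trans τ).trans e) := by
  obtain ⟨G, hG, hGD⟩ := hτ
  refine ⟨(e.symm ⁻¹' ·) '' G, hG.image _, fun D hD => ?_⟩
  obtain ⟨D', hD', hDD'⟩ := hGD (e ⁻¹' D) (by
    have := hD.preimage e.injective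
    simpa [AlmostEq] using this)
  refine ⟨_, mem_image_of_mem _ hD', ?_⟩
  have := hDD'.preimage e.symm.injective
  simpa [AlmostEq] using this

theorem exists_perm_preserving_fewAlmostInvariant {Y : Type} [Finite Y] (c : ℕ → Y) :
    ∃ σ : Equiv.Perm ℕ, (∀ n, c (σ n) = c n) ∧ FewAlmostInvariant σ := by
  choose τ hτ using fun y => exists_fewAlmostInvariant {n // c n = y}
  refine ⟨_, fun n => ?_, (FewAlmostInvariant.sigma hτ).conj (Equiv.sigmaFiberEquiv c)⟩
  exact (τ (c n) ⟨n, rfl⟩).2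

/-- The involution of `ℕ × Bool` that flips the second coordinate over the points of `D`. -/
noncomputable def flipOver (D : Set ℕ) : Equiv.Perm (ℕ × Bool) := by
  classical
  exact Function.Involutive.toPerm (fun p => (p.1, if p.1 ∈ D then !p.2 else p.2)) fun p => by
    by_cases h : p.1 ∈ D <;> simp [h]

open Classical in
theorem flipOver_apply (D : Set ℕ) (n : ℕ) (b : Bool) :
    flipOver D (n, b) = (n, if n ∈ D then !b else b) := rfl

/-- The row `true` of the flipped set is a copy of `D`, so `D` can be recovered modulo finite sets
from the image modulo finite sets. -/
theorem mem_image_flipOver (D : Set ℕ) (n : ℕ) :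
    (n, true) ∈ flipOver D '' {p | p.2 = false} ↔ n ∈ D := by
  constructor
  · rintro ⟨⟨m, b⟩, hb, h⟩
    simp only [mem_ofPred_eq] at hb
    subst hb
    by_contra hn
    rw [flipOver_apply, Prod.mk.injEq] at h
    obtain ⟨rfl, h⟩ := h
    simp [hn] at h
  · intro hn
    exact ⟨(n, false), rfl, by simp [flipOver_apply, hn]⟩

theorem exists_perms_separating {Y : Type} [Finite Y] (c : ℕ → Y) :
    ∃ (A : Set ℕ) (σ : Set ℕ → Equiv.Perm ℕ), (∀ D n, c (σ D n) = c n) ∧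
      ∀ D E, AlmostEq (σ D '' A) (σ E '' A) → AlmostEq D E := by
  classical
  -- The flips live on a copy of `ℕ × Bool` filling one infinite colour class and fix everything
  -- else.
  obtain ⟨y, hy⟩ := Finite.exists_infinite_fiber c
  obtain ⟨e₀⟩ := nonempty_equiv_of_countable (α := ℕ × Bool) (β := c ⁻¹' {y})
  let e : ℕ × Bool ↪ ℕ := e₀.toEmbedding.trans (Function.Embedding.subtype _)
  have he (p : ℕ × Bool) : c (e p) = y := (e₀ p).2
  refine ⟨e '' {p | p.2 = false}, fun D => (flipOver D).viaEmbedding e, fun D n => ?_,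
    fun D E h => ?_⟩
  · by_cases hn : n ∈ range e
    · obtain ⟨p, rfl⟩ := hn
      rw [Equiv.Perm.viaEmbedding_apply, he, he]
    · rw [Equiv.Perm.viaEmbedding_apply_of_notMem _ _ _ hn]
  · have himg (D : Set ℕ) : (flipOver D).viaEmbedding e '' (e '' {p | p.2 = false}) =
        e '' (flipOver D '' {p | p.2 = false}) := by
      rw [image_image, image_image]
      exact image_congr fun p _ => Equiv.Perm.viaEmbedding_apply _ _ _
    rw [himg, himg] at h
    have := h.preimage (e := fun n => e (n, true)) fun m n hmn => by simpa using hmn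
    simpa only [AlmostEq, mem_preimage, e.injective.mem_set_image, mem_image_flipOver] using this

end AlmostEq

/-! ### Transfer of the combinatorics to `ω*`. -/

section OmegaStar

theorem continuum_le_mk_isClopen_omegaStar : 𝔠 ≤ #{A : Set OmegaStar | IsClopen A} :=
  (continuum_le_mk_range starSet fun _ _ => starSet_eq_iff.1).trans
    (Cardinal.mk_le_mk_of_subset (range_subset_iff.2 isClopen_starSet))

theorem mk_isClopen_omegaStar_le : #{A : Set OmegaStar | IsClopen A} ≤ 𝔠 := by
  refine (Cardinal.mk_le_mk_of_subset fun C hC => exists_starSet_eq hC).trans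
    ((Cardinal.mk_range_le (f := starSet)).trans ?_)
  rw [Cardinal.mk_set, Cardinal.mk_nat, Cardinal.two_power_aleph0]

/-- Finitely many clopen subsets of `ω*` are preserved by every permutation of `ω` that respects
a suitable finite colouring. -/
theorem exists_colouring {F : Set (Set OmegaStar)} (hF : F.Finite) (hFc : ∀ A ∈ F, IsClopen A) :
    ∃ (Y : Type) (_ : Finite Y) (c : ℕ → Y), ∀ σ : Equiv.Perm ℕ, (∀ n, c (σ n) = c n) →
      ∀ A ∈ F, omegaStarHomeo σ '' A = A := by
  have : Finite F := hF
  choose a ha using fun A : F => exists_starSet_eq (hFc A.1 A.2)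
  -- The colour of `n` records which of the chosen representatives contain it.
  refine ⟨Set F, inferInstance, fun n => {A | n ∈ a A}, fun σ hσ A hA => ?_⟩
  have hmem (n : ℕ) : σ n ∈ a ⟨A, hA⟩ ↔ n ∈ a ⟨A, hA⟩ := Set.ext_iff.1 (hσ n) ⟨A, hA⟩
  have himg : σ '' a ⟨A, hA⟩ = a ⟨A, hA⟩ := by
    ext n
    obtain ⟨m, rfl⟩ := σ.surjective n
    rw [σ.injective.mem_set_image, hmem]
  have hstar : starSet (a ⟨A, hA⟩) = A := ha ⟨A, hA⟩
  rw [← hstar, omegaStarHomeo_image_starSet, himg]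

theorem hasFiniteInvariants_omegaStar : HasFiniteInvariants OmegaStar := by
  intro F hF hFc
  obtain ⟨Y, _, c, hc⟩ := exists_colouring hF hFc
  obtain ⟨σ, hσ, G, hG, hGD⟩ := exists_perm_preserving_fewAlmostInvariant c
  refine ⟨omegaStarHomeo σ, hc σ hσ, (hG.image starSet).subset ?_⟩
  rintro C ⟨hC, hinv⟩
  obtain ⟨D, rfl⟩ := exists_starSet_eq hC
  rw [omegaStarHomeo_image_starSet, starSet_eq_iff] at hinv
  have hpre := hinv.preimage σ.injective
  rw [preimage_image_eq _ σ.injective] at hpre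
  obtain ⟨D', hD', hDD'⟩ := hGD D hpre.symm
  exact ⟨D', hD', starSet_eq_iff.2 hDD'.symm⟩

theorem exists_large_orbit_omegaStar (F : Set (Set OmegaStar)) (hF : F.Finite)
    (hFc : ∀ A ∈ F, IsClopen A) : ∃ A : Set OmegaStar, IsClopen A ∧
      𝔠 ≤ #{C | ∃ h : OmegaStar ≃ₜ OmegaStar, (∀ B ∈ F, h '' B = B) ∧ h '' A = C} := by
  obtain ⟨Y, _, c, hc⟩ := exists_colouring hF hFc
  obtain ⟨A, σ, hσ, hsep⟩ := exists_perms_separating c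
  refine ⟨starSet A, isClopen_starSet A,
    (continuum_le_mk_range (fun D => omegaStarHomeo (σ D) '' starSet A) fun D E h => ?_).trans
      (Cardinal.mk_le_mk_of_subset ?_)⟩
  · simp only [omegaStarHomeo_image_starSet] at h
    exact hsep D E (starSet_eq_iff.1 h)
  · rintro _ ⟨D, rfl⟩
    exact ⟨_, hc _ (hσ D), rfl⟩

end OmegaStar

theorem proposition4p4 (U : Set (OmegaStar ≃ₜ OmegaStar)) (hU : IsOpen U) (hne : U.Nonempty) :
    CardFn.weight U = 𝔠 ∧ CardFn.character U = 𝔠 ∧ CardFn.piCharacter U = 𝔠 ∧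
      CardFn.cellularity U = 𝔠 ∧ CardFn.density U = 𝔠 ∧ CardFn.tightness U = 𝔠 := by
  have hinf : Infinite {A : Set OmegaStar // IsClopen A} :=
    Cardinal.aleph0_le_mk_iff.1
      (Cardinal.aleph0_le_continuum.trans continuum_le_mk_isClopen_omegaStar)
  have hw : CardFn.weight U ≤ 𝔠 := (weight_le_mk_isClopen U).trans mk_isClopen_omegaStar_le
  have hc : 𝔠 ≤ CardFn.cellularity U := le_cellularity exists_large_orbit_omegaStar hU hne
  obtain ⟨f, hf⟩ := hne
  have hp : 𝔠 ≤ CardFn.piCharacter U :=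
    (le_piCharacterAt Cardinal.aleph0_lt_continuum continuum_le_mk_isClopen_omegaStar
      hasFiniteInvariants_omegaStar hU ⟨f, hf⟩).trans (CardFn.piCharacterAt_le_piCharacter _)
  have ht : 𝔠 ≤ CardFn.tightness U :=
    (le_tightnessAt Cardinal.aleph0_lt_continuum continuum_le_mk_isClopen_omegaStar
      hasFiniteInvariants_omegaStar hU ⟨f, hf⟩).trans (CardFn.tightnessAt_le_tightness _)
  have hcd := CardFn.cellularity_le_density U
  have hdw := CardFn.density_le_weight U
  have hpx := CardFn.piCharacter_le_character U
  have htx := CardFn.tightness_le_character U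
  have hxw := CardFn.character_le_weight U
  exact ⟨hw.antisymm (hc.trans (hcd.trans hdw)), (hxw.trans hw).antisymm (hp.trans hpx),
    (hpx.trans (hxw.trans hw)).antisymm hp, (hcd.trans (hdw.trans hw)).antisymm hc,
    (hdw.trans hw).antisymm (hc.trans hcd), (htx.trans (hxw.trans hw)).antisymm ht⟩
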